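/- Let $\mathbb{F}_q$ be a finite field, let $C$ be a nonsingular projective curve over $\mathbb{F}_q$, let $\infty$ be a closed point of $C$, and let $A$ be the ring of functions on $C$ that are regular everywhere except possibly at $\infty$. Let $F$ be a countable algebraically closed field containing $\mathbb{F}_q$, and let $K$ be a finitely generated field extension of $F$ of positive transcendence degree over $F$. Let $F\{\tau\}$ be the ring of polynomials in $\tau$ with coefficients in $F$, where $\tau$ is the operator $x\mapsto x^q$ and multiplication is composition (so $\tau c=c^q\tau$ for $c\in F$). Let $i:A\to F$ be a morphism of $\mathbb{F}_q$-algebras, and let $\phi:A\to F\{\tau\}$, $a\mapsto\phi_a$, be a Drinfeld module over $F$, that is, a ring homomorphism such that the coefficient of $\tau^0$ in $\phi_a$ is $i(a)$ for every $a\in A$, and $\phi_a\neq i(a)\tau^0$ for some $a\in A$. For every field $L$ containing $F$, let $\phi(L)$ be the additive group of $L$ with the $A$-module structure in which $a\in A$ acts by $x\mapsto\phi_a(x)$. Then there is a free $A$-submodule $N$ of $\phi(K)$ of rank $\aleph_0$ such that $$\phi(K)=\phi(F)\oplus N .$$ -/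

import Mathlib

/-! ### Nonsingular projective curves over a finite field

The nonsingular projective curve with function field `k / Fq` is the abstract nonsingular curve of
`k`: its closed points are the nontrivial valuation rings of `k` containing `Fq` (these are the
local rings of the curve at its closed points), and a rational function is regular at a closed point
when it belongs to the corresponding valuation ring. -/

/-- The closed points of the nonsingular projective curve over `Fq` with function field `k`. -/
structure ClosedPoint (Fq k : Type*) [Field Fq] [Field k] [Algebra Fq k] where
  /-- the local ring of the curve at the point -/
  localRing : ValuationSubring k
  algebraMap_mem : ∀ c : Fq, algebraMap Fq k c ∈ localRing
  ne_top : localRing ≠ ⊤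

/-- The ring of functions on the curve that are regular everywhere except possibly at `pt`. -/
def ringRegularAwayFrom {Fq k : Type*} [Field Fq] [Field k] [Algebra Fq k]
    (pt : ClosedPoint Fq k) : Subalgebra Fq k where
  carrier := {f | ∀ P : ClosedPoint Fq k, P ≠ pt → f ∈ P.localRing}
  mul_mem' hf hg P hP := mul_mem (hf P hP) (hg P hP)
  add_mem' hf hg P hP := add_mem (hf P hP) (hg P hP)
  algebraMap_mem' c P _ := P.algebraMap_mem c

/-! ### Twisted polynomials -/

theorem add_pow_card_pow (Fq : Type*) {L : Type*} [Field Fq] [Fintype Fq] [Field L] [Algebra Fq L]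
    (n : ℕ) (x y : L) :
    (x + y) ^ Fintype.card Fq ^ n = x ^ Fintype.card Fq ^ n + y ^ Fintype.card Fq ^ n := by
  induction n with
  | zero => simp
  | succ n ih =>
    rw [pow_succ, pow_mul, ih, pow_mul, pow_mul]
    exact map_add (FiniteField.frobeniusAlgHom Fq L) _ _

/-- The action of the monoid of powers of `τ` on an extension `F` of the finite field `Fq`, where
`τ` acts as `x ↦ x ^ q` with `q` the cardinality of `Fq`. -/
@[reducible] def frobeniusAction (Fq F : Type*) [Field Fq] [Fintype Fq] [Field F]
    [Algebra Fq F] : MulSemiringAction (Multiplicative ℕ) F where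
  smul n x := x ^ Fintype.card Fq ^ n.toAdd
  one_smul x := by change x ^ Fintype.card Fq ^ 0 = x; simp
  mul_smul m n x := by
    change x ^ Fintype.card Fq ^ (m.toAdd + n.toAdd) =
      (x ^ Fintype.card Fq ^ n.toAdd) ^ Fintype.card Fq ^ m.toAdd
    rw [← pow_mul, ← pow_add, add_comm]
  smul_zero n := zero_pow (pow_ne_zero _ Fintype.card_ne_zero)
  smul_add n x y := add_pow_card_pow Fq n.toAdd x y
  smul_one n := one_pow _
  smul_mul n x y := mul_pow x y _

/-- The powers of `τ` as additive endomorphisms `x ↦ x ^ (q ^ n)` of an extension `L` of `Fq`. -/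
def frobeniusEnd (Fq L : Type*) [Field Fq] [Fintype Fq] [Field L] [Algebra Fq L] :
    Multiplicative ℕ →* AddMonoid.End L where
  toFun n :=
    { toFun := fun x => x ^ Fintype.card Fq ^ n.toAdd
      map_zero' := zero_pow (pow_ne_zero _ Fintype.card_ne_zero)
      map_add' := add_pow_card_pow Fq n.toAdd }
  map_one' := by
    ext x
    change x ^ Fintype.card Fq ^ 0 = x
    simp
  map_mul' m n := by
    ext x
    change x ^ Fintype.card Fq ^ (m.toAdd + n.toAdd) =
      (x ^ Fintype.card Fq ^ n.toAdd) ^ Fintype.card Fq ^ m.toAdd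
    rw [← pow_mul, ← pow_add, add_comm]

/-- The ring `F{τ}` of polynomials in `τ` with coefficients in `F`, with the usual addition and with
the multiplication determined by `τ c = c ^ q τ`, where `q` is the cardinality of `Fq`. -/
def TwistedPolynomial (Fq F : Type*) [Field Fq] [Fintype Fq] [Field F] [Algebra Fq F] : Type _ :=
  SkewPolynomial F

namespace TwistedPolynomial

noncomputable instance instRing (Fq F : Type*) [Field Fq] [Fintype Fq] [Field F] [Algebra Fq F] :
    Ring (TwistedPolynomial Fq F) :=
  letI := frobeniusAction Fq F
  inferInstanceAs (Ring (SkewMonoidAlgebra F (Multiplicative ℕ)))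

variable {Fq F : Type*} [Field Fq] [Fintype Fq] [Field F] [Algebra Fq F]

/-- The coefficient of `τ ^ n`. -/
noncomputable def coeff (f : TwistedPolynomial Fq F) (n : ℕ) : F := SkewPolynomial.coeff f n

/-- The twisted polynomial `c τ ^ n`. -/
noncomputable def monomial (n : ℕ) (c : F) : TwistedPolynomial Fq F := SkewPolynomial.monomial n c

theorem monomial_mul_monomial (m n : ℕ) (c d : F) :
    (monomial m c * monomial n d : TwistedPolynomial Fq F) =
      monomial (m + n) (c * d ^ Fintype.card Fq ^ m) := by
  let _ := frobeniusAction Fq F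
  exact SkewMonoidAlgebra.single_mul_single (k := F)

/-- A twisted polynomial acts on every extension `L` of `F` as an additive endomorphism, with `τ`
acting as `x ↦ x ^ q`; multiplication of twisted polynomials becomes composition. -/
noncomputable def eval (Fq F L : Type*) [Field Fq] [Fintype Fq] [Field F] [Algebra Fq F] [Field L]
    [Algebra Fq L] [Algebra F L] : TwistedPolynomial Fq F →+* AddMonoid.End L :=
  letI := frobeniusAction Fq F
  SkewMonoidAlgebra.liftNCRingHom (Module.toAddMonoidEnd F L) (frobeniusEnd Fq L) (by
    intro c n
    ext x
    change (c ^ Fintype.card Fq ^ n.toAdd) • x ^ Fintype.card Fq ^ n.toAdd =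
      (c • x) ^ Fintype.card Fq ^ n.toAdd
    simp only [Algebra.smul_def, mul_pow, map_pow])

/-- The action of `f = ∑ cₙ τ ^ n` is `x ↦ ∑ cₙ x ^ (q ^ n)`. -/
theorem eval_apply (L : Type*) [Field L] [Algebra Fq L] [Algebra F L] (f : TwistedPolynomial Fq F)
    (x : L) : eval Fq F L f x =
      ∑ n ∈ SkewPolynomial.support f, algebraMap F L (coeff f n) * x ^ Fintype.card Fq ^ n := by
  have h : ∀ (n : ℕ) (c : F), eval Fq F L (SkewPolynomial.monomial n c : SkewPolynomial F) x =
      algebraMap F L c * x ^ Fintype.card Fq ^ n := by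
    intro n c
    let _ := frobeniusAction Fq F
    refine (congrArg (fun g : AddMonoid.End L => g x) (SkewMonoidAlgebra.liftNC_single
      (Module.toAddMonoidEnd F L : F →+ AddMonoid.End L) _ (Multiplicative.ofAdd n) c)).trans ?_
    exact Algebra.smul_def c (x ^ Fintype.card Fq ^ n)
  let e : SkewPolynomial F →+ L :=
    { toFun := fun g => eval Fq F L g x
      map_zero' := congrArg (fun g : AddMonoid.End L => g x) (map_zero (eval Fq F L))
      map_add' := fun g₁ g₂ =>
        congrArg (fun g : AddMonoid.End L => g x) (map_add (eval Fq F L) g₁ g₂) }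
  have hf : ∑ n ∈ SkewPolynomial.support f,
      SkewPolynomial.monomial n (SkewPolynomial.coeff f n) = f :=
    (SkewPolynomial.sum_def (R := F) f _).symm.trans (SkewPolynomial.sum_monomial (R := F) f)
  calc eval Fq F L f x = e f := rfl
    _ = e (∑ n ∈ SkewPolynomial.support f,
          SkewPolynomial.monomial n (SkewPolynomial.coeff f n)) := by rw [hf]
    _ = _ := by rw [map_sum]; exact Finset.sum_congr rfl fun n _ => h n _

end TwistedPolynomial

/-! ### Drinfeld modules -/

/-- A Drinfeld `A`-module over `F`, relative to a fixed morphism `i : A → F`: a ring homomorphism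
`φ : A → F{τ}` such that the coefficient of `τ ^ 0` in `φ_a` is `i a` for all `a`, and such that
`φ_a ≠ i(a) τ ^ 0` for some `a`. -/
structure DrinfeldModule {Fq A F : Type*} [Field Fq] [Fintype Fq] [CommRing A] [Algebra Fq A]
    [Field F] [Algebra Fq F] (i : A →ₐ[Fq] F) where
  toRingHom : A →+* TwistedPolynomial Fq F
  coeff_zero : ∀ a, (toRingHom a).coeff 0 = i a
  exists_ne : ∃ a, toRingHom a ≠ TwistedPolynomial.monomial 0 (i a)

namespace DrinfeldModule

variable {Fq A F : Type*} [Field Fq] [Fintype Fq] [CommRing A] [Algebra Fq A]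
    [Field F] [Algebra Fq F] {i : A →ₐ[Fq] F}

/-- `φ(L)`: the additive group of an extension `L` of `F`, with `a : A` acting through `φ_a`. -/
@[nolint unusedArguments]
def Points (_ : DrinfeldModule i) (L : Type*) : Type _ := L

variable (φ : DrinfeldModule i) (L : Type*) [Field L] [Algebra Fq L] [Algebra F L]

noncomputable instance instAddCommGroupPoints : AddCommGroup (φ.Points L) :=
  inferInstanceAs (AddCommGroup L)

noncomputable instance instModulePoints : Module A (φ.Points L) :=
  Module.compHom L ((TwistedPolynomial.eval Fq F L).comp φ.toRingHom)

theorem smul_def (a : A) (x : φ.Points L) :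
    a • x = TwistedPolynomial.eval Fq F L (φ.toRingHom a) x := rfl

/-- `φ(F)` as an `A`-submodule of `φ(L)`, for an extension `L` of `F`: the elements of `F`. -/
noncomputable def basePoints : Submodule A (φ.Points L) where
  carrier := Set.range (algebraMap F L)
  zero_mem' := ⟨0, map_zero _⟩
  add_mem' := by
    rintro _ _ ⟨x, rfl⟩ ⟨y, rfl⟩
    exact ⟨x + y, map_add _ x y⟩
  smul_mem' := by
    rintro a _ ⟨x, rfl⟩
    have h : algebraMap F L (TwistedPolynomial.eval Fq F F (φ.toRingHom a) x) =
        TwistedPolynomial.eval Fq F L (φ.toRingHom a) (algebraMap F L x) := by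
      rw [TwistedPolynomial.eval_apply, TwistedPolynomial.eval_apply]
      simp
    exact ⟨_, h⟩

end DrinfeldModule

/-! ### Countable modules over a Dedekind domain. -/

section DedekindModules

open Module

/-! Everything happens in M = φ(K)/φ(F): once M is free, the quotient map splits. Since F is
algebraically closed and K is finitely generated but not algebraic over F, there is a family of
discrete valuations, trivial on F, such that each element of K has finitely many poles and only
elements of F have none (`exists_isPoleFamily`). The largest pole order induces an ultrametric
height on M. If φ_t has degree d > 0 in τ, then t multiplies each pole order by q^d, so it raises
the height of every nonzero class.

Let X act on M as t, making M a module over Fq[X]. The height makes M torsion-free, and a descent in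
the style of Mordell-Weil shows that submodules of finite rank are finitely generated and have
finite balls. Applied to an orbit A·m, this makes A finite over Fq[X]; being integrally closed, A is
then Dedekind. M itself is not finitely generated: for x outside F, the classes of cx with c in F
are infinitely many and of bounded height.

It remains to see that such an M is free (`IsDedekindDomain.nonempty_finsupp_equiv`). It is a
countable direct sum of projectives of rank at least two, each of which surjects onto A. Hence M ≅ P
⊕ A^(ℕ) with P projective and countable, and the Eilenberg swindle absorbs P. -/

theorem IsDedekindDomain.projective_of_isTorsionFree (A M : Type*) [CommRing A] [IsDedekindDomain A]
    [AddCommGroup M] [Module A M] [Module.Finite A M] [IsTorsionFree A M] : Projective A M :=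
  haveI := Module.finitePresentation_of_finite A M
  Flat.projective_of_finitePresentation

theorem LinearMap.exists_eq_mul_of_forall_dvd {A M : Type*} [CommRing A] [IsDomain A]
    [AddCommGroup M] [Module A M] (f : M →ₗ[A] A) {b : A} (hb : b ≠ 0) (h : ∀ x, b ∣ f x) :
    ∃ g : M →ₗ[A] A, ∀ x, f x = b * g x := by
  choose g hg using h
  refine ⟨⟨⟨g, fun x y => mul_left_cancel₀ hb ?_⟩, fun c x => mul_left_cancel₀ hb ?_⟩, hg⟩
  · rw [mul_add, ← hg, ← hg, ← hg, map_add]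
  · rw [← hg, map_smul, hg, smul_eq_mul, RingHom.id_apply, smul_eq_mul, mul_left_comm]

/-- Two nonzero functionals on modules over a Dedekind domain can be combined, after
changing the first one, to a surjective functional on the product. -/
theorem IsDedekindDomain.exists_surjective_coprod {A P Q : Type*} [CommRing A] [IsDedekindDomain A]
    [AddCommGroup P] [Module A P] [AddCommGroup Q] [Module A Q] {f : P →ₗ[A] A} {g : Q →ₗ[A] A}
    (hf : f ≠ 0) (hg : g ≠ 0) : ∃ f' : P →ₗ[A] A, Function.Surjective (f'.coprod g) := by
  obtain ⟨x₀, hx₀⟩ : ∃ x, f x ≠ 0 := by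
    by_contra! h
    exact hf (LinearMap.ext h)
  obtain ⟨y₀, hy₀⟩ : ∃ x, g x ≠ 0 := by
    by_contra! h
    exact hg (LinearMap.ext h)
  set b := f x₀
  obtain ⟨I', hI'⟩ : LinearMap.range f ∣ Ideal.span {b} := by
    rw [Ideal.dvd_iff_le, Ideal.span_singleton_le_iff_mem]
    exact ⟨x₀, rfl⟩
  have hJ0 : LinearMap.range g ≠ (0 : Ideal A) := fun h =>
    hy₀ (by
      have := LinearMap.mem_range_self g y₀
      rwa [h, Ideal.zero_eq_bot, Ideal.mem_bot] at this)
  have hI'0 : I' ≠ 0 := by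
    rintro rfl
    simp [hx₀] at hI'
  -- With I = range f, J = range g and I I' = (b), choose a such that J I' + (a) = I'. Then f' =
  -- (a/b) f takes values in A, and range f' + J = b⁻¹ I ((a) + I' J) = b⁻¹ I I' = A.
  obtain ⟨a, ha⟩ := IsDedekindDomain.exists_sup_span_eq
    (Ideal.mul_le_right : LinearMap.range g * I' ≤ I') (mul_ne_zero hJ0 hI'0)
  have haI : a ∈ I' := ha ▸ Ideal.mem_sup_right (Ideal.mem_span_singleton_self a)
  obtain ⟨f', hf'⟩ := (a • f).exists_eq_mul_of_forall_dvd hx₀ (fun x => by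
    rw [← Ideal.mem_span_singleton, hI', LinearMap.smul_apply, smul_eq_mul, mul_comm a]
    exact Ideal.mul_mem_mul ⟨x, rfl⟩ haI)
  refine ⟨f', LinearMap.range_eq_top.mp ((Ideal.eq_top_iff_one _).mpr ?_)⟩
  have hbm : b ∈ Ideal.span {b} * LinearMap.range g ⊔ LinearMap.range f * Ideal.span {a} := by
    rw [hI', mul_assoc, mul_comm I', ← Ideal.mul_sup, ha, ← hI']
    exact Ideal.mem_span_singleton_self b
  obtain ⟨u, hu, v, hv, huv⟩ := Submodule.mem_sup.mp hbm
  obtain ⟨_, ⟨y, rfl⟩, rfl⟩ := Ideal.mem_span_singleton_mul.mp hu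
  obtain ⟨_, ⟨x, rfl⟩, rfl⟩ := Ideal.mem_mul_span_singleton.mp hv
  refine ⟨(x, y), mul_left_cancel₀ hx₀ ?_⟩
  have := hf' x
  simp only [LinearMap.smul_apply, smul_eq_mul] at this
  rw [LinearMap.coprod_apply, mul_add, ← this, mul_one, mul_comm a, add_comm]
  exact huv

/-- A finitely generated torsion-free module of rank at least two over a Dedekind domain has a
surjective functional. -/
theorem IsDedekindDomain.exists_surjective_dual {A P N : Type*} [CommRing A]
    [IsDedekindDomain A] [AddCommGroup P] [Module A P] [AddCommGroup N] [Module A N]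
    [Module.Finite A P] [IsTorsionFree A P] [IsTorsionFree A N] (p : P →ₗ[A] N)
    (hker : LinearMap.ker p ≠ ⊥) (hp : p ≠ 0) : ∃ f : P →ₗ[A] A, Function.Surjective f := by
  have : IsTorsionFree A (LinearMap.range p) :=
    (LinearMap.range p).injective_subtype.moduleIsTorsionFree _ (fun _ _ => rfl)
  have : IsTorsionFree A (LinearMap.ker p) :=
    (LinearMap.ker p).injective_subtype.moduleIsTorsionFree _ (fun _ _ => rfl)
  have := projective_of_isTorsionFree A (LinearMap.range p)
  have := projective_of_isTorsionFree A (LinearMap.ker p)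
  -- The range of p is projective, so P splits as ker p ⊕ range p; both summands are nonzero and
  -- carry a nonzero functional.
  obtain ⟨s, hs⟩ := p.rangeRestrict.exists_rightInverse_of_surjective p.range_rangeRestrict
  obtain ⟨x, hx, hx0⟩ := Submodule.exists_mem_ne_zero_of_ne_bot hker
  obtain ⟨y, hy⟩ : ∃ y, p y ≠ 0 := by
    by_contra! h
    exact hp (LinearMap.ext h)
  obtain ⟨f, hf⟩ := Projective.exists_dual_ne_zero A (x := (⟨x, hx⟩ : LinearMap.ker p))
    (fun h => hx0 congr($h))
  obtain ⟨g, hg⟩ := Projective.exists_dual_ne_zero A (x := p.rangeRestrict y)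
    (fun h => hy congr($h))
  obtain ⟨f', h⟩ := exists_surjective_coprod (f := f) (g := g) (fun h => hf (by simp [h]))
    (fun h => hg (by simp [h]))
  have e : (LinearMap.ker p × LinearMap.range p) ≃ₗ[A] P :=
    lequivProdOfRightSplitExact (j := (LinearMap.ker p).subtype)
      (LinearMap.ker p).injective_subtype (by simp) hs
  exact ⟨(f'.coprod g).comp e.symm.toLinearMap, h.comp e.symm.surjective⟩

/-- The Eilenberg swindle. -/
theorem Module.Projective.nonempty_prod_finsupp_equiv (A P : Type*) [CommRing A] [AddCommGroup P]
    [Module A P] [Projective A P] [Countable P] :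
    Nonempty ((P × (ℕ →₀ A)) ≃ₗ[A] (ℕ →₀ A)) := by
  obtain ⟨u, hu⟩ := exists_surjective_nat P
  have hsurj : LinearMap.range (Finsupp.linearCombination A u) = ⊤ := by
    rw [Finsupp.range_linearCombination, hu.range_eq, Submodule.span_univ]
  obtain ⟨s, hs⟩ := (Finsupp.linearCombination A u).exists_rightInverse_of_surjective hsurj
  set Q := LinearMap.ker (Finsupp.linearCombination A u)
  let e : (Q × P) ≃ₗ[A] (ℕ →₀ A) := lequivProdOfRightSplitExact (A := Q) (j := Q.subtype)
    Q.injective_subtype (Submodule.range_subtype Q) hs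
  let prodEquiv : (ℕ →₀ Q × P) ≃ₗ[A] ((ℕ →₀ Q) × (ℕ →₀ P)) :=
    LinearEquiv.ofLinearMap
      ((Finsupp.mapRange.linearMap (LinearMap.fst A Q P)).prod
        (Finsupp.mapRange.linearMap (LinearMap.snd A Q P)))
      ((Finsupp.mapRange.linearMap (LinearMap.inl A Q P)).coprod
        (Finsupp.mapRange.linearMap (LinearMap.inr A Q P)))
      (by ext <;> simp) (by ext <;> simp)
  let shift : (P × (ℕ →₀ P)) ≃ₗ[A] (ℕ →₀ P) :=
    (LinearEquiv.prodCongr (Finsupp.uniqueLinearEquiv A P ()).symm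
      (LinearEquiv.refl A _)).trans
      ((Finsupp.sumFinsuppLEquivProdFinsupp A).symm.trans
        (Finsupp.domLCongr ((Equiv.sumComm _ _).trans (Equiv.natSumPUnitEquivNat))))
  let e' : (ℕ →₀ Q × P) ≃ₗ[A] (ℕ →₀ A) :=
    (Finsupp.mapRange.linearEquiv e).trans
      ((Finsupp.curryLinearEquiv A).symm.trans (Finsupp.domLCongr Nat.pairEquiv))
  -- P ⊕ A^(ℕ) ≅ P ⊕ Q^(ℕ) ⊕ P^(ℕ) ≅ Q^(ℕ) ⊕ P^(ℕ) ≅ A^(ℕ), where the middle step shifts the extra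
  -- copy of P into P^(ℕ).
  exact ⟨(LinearEquiv.prodCongr (LinearEquiv.refl A P) (e'.symm.trans prodEquiv)).trans
    ((LinearEquiv.prodAssoc A P _ _).symm.trans
    ((LinearEquiv.prodCongr (LinearEquiv.prodComm A _ _) (LinearEquiv.refl A _)).trans
    ((LinearEquiv.prodAssoc A _ P _).trans
    ((LinearEquiv.prodCongr (LinearEquiv.refl A _) shift).trans
      (prodEquiv.symm.trans e')))))⟩

/-- In a relation, the image of the top nonzero component is minus a sum of lower images, so it lies
in `S n`, which forces that component to vanish. -/
theorem DirectSum.toModule_injective_of_filtration {A M : Type*} [CommRing A] [AddCommGroup M]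
    [Module A M] {V : ℕ → Type*} [∀ n, AddCommGroup (V n)] [∀ n, Module A (V n)]
    (S : ℕ → Submodule A M) (hS : Monotone S) (s : ∀ n, V n →ₗ[A] M)
    (hmem : ∀ n x, s n x ∈ S (n + 1)) (hs : ∀ n x, s n x ∈ S n → x = 0) :
    Function.Injective (DirectSum.toModule A ℕ M s) := by
  classical
  refine (injective_iff_map_eq_zero _).mpr fun x hx => ?_
  by_contra hne
  have hsupp : (DFinsupp.support x).Nonempty := by
    rwa [Finset.nonempty_iff_ne_empty, ne_eq, DFinsupp.support_eq_empty]
  set n := (DFinsupp.support x).max' hsupp with hn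
  have hxn : x n ≠ 0 := DFinsupp.mem_support_iff.mp (Finset.max'_mem _ hsupp)
  have hsum : DirectSum.toModule A ℕ M s x = ∑ m ∈ DFinsupp.support x, s m (x m) := by
    conv_lhs => rw [← DirectSum.sum_support_of x, map_sum]
    exact Finset.sum_congr rfl fun m _ => DirectSum.toModule_lof A m (x m)
  rw [hx, ← Finset.add_sum_erase _ _ (Finset.max'_mem _ hsupp), ← hn] at hsum
  refine hxn (hs n _ ?_)
  rw [eq_neg_of_add_eq_zero_left hsum.symm]
  refine neg_mem (sum_mem fun m hm => ?_)
  have hmn : m < n := lt_of_le_of_ne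
    (Finset.le_max' _ _ (Finset.mem_of_mem_erase hm)) (Finset.ne_of_mem_erase hm)
  exact hS hmn (hmem m (x m))

/-- A module with an exhaustive filtration indexed by `ℕ` with projective graded pieces is
isomorphic to the associated graded module. -/
theorem Submodule.nonempty_directSum_quotient_equiv {A M : Type*} [CommRing A] [AddCommGroup M]
    [Module A M] (S : ℕ → Submodule A M) (hS : Monotone S) (h0 : S 0 = ⊥)
    (htop : ∀ x, ∃ n, x ∈ S n)
    [∀ n, Projective A (S (n + 1) ⧸ (S n).submoduleOf (S (n + 1)))] :
    Nonempty ((DirectSum ℕ fun n => S (n + 1) ⧸ (S n).submoduleOf (S (n + 1))) ≃ₗ[A] M) := by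
  have hsec : ∀ n, ∃ s : (S (n + 1) ⧸ (S n).submoduleOf (S (n + 1))) →ₗ[A] S (n + 1),
      (Submodule.mkQ _).comp s = LinearMap.id := fun n =>
    (Submodule.mkQ _).exists_rightInverse_of_surjective (Submodule.range_mkQ _)
  choose s hs using hsec
  let Φ := DirectSum.toModule A ℕ M fun n => (S (n + 1)).subtype.comp (s n)
  have hΦ : ∀ n x, Φ (DirectSum.lof A ℕ _ n x) = s n x := fun n x => by
    simp [Φ]
  have hsurj : ∀ n, ∀ x ∈ S n, x ∈ LinearMap.range Φ := by
    intro n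
    induction n with
    | zero =>
      intro x hx
      rw [h0, Submodule.mem_bot] at hx
      exact hx ▸ zero_mem _
    | succ n ih =>
      intro x hx
      set y := Submodule.Quotient.mk (p := (S n).submoduleOf (S (n + 1))) ⟨x, hx⟩ with hy
      have h1 : x - s n y ∈ S n := by
        have h2 : Submodule.Quotient.mk (s n y) = y := congr($(hs n) y)
        rw [hy, eq_comm, Submodule.Quotient.eq, ← hy] at h2
        exact h2
      have := add_mem (ih _ h1) (⟨_, hΦ n y⟩ : (s n y : M) ∈ LinearMap.range Φ)
      simpa using this
  refine ⟨LinearEquiv.ofBijective Φ ⟨?_, fun x => ?_⟩⟩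
  · refine DirectSum.toModule_injective_of_filtration S hS _ (fun n x => (s n x).2)
      fun n x hx => ?_
    have h2 : Submodule.Quotient.mk (s n x) = x := congr($(hs n) x)
    rw [← h2]
    exact (Submodule.Quotient.mk_eq_zero _).mpr hx
  · obtain ⟨n, hn⟩ := htop x
    exact hsurj n x hn

theorem Submodule.ker_mapQ_submoduleOf {A M : Type*} [CommRing A] [AddCommGroup M] [Module A M]
    (S S' : Submodule A M) :
    LinearMap.ker ((S.submoduleOf S').mapQ S S'.subtype le_rfl) = ⊥ :=
  Submodule.ker_liftQ_eq_bot' _ _ (by ext; simp [Submodule.submoduleOf])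

theorem Submodule.isTorsionFree_quotient_submoduleOf {A M : Type*} [CommRing A] [AddCommGroup M]
    [Module A M] (S S' : Submodule A M) [IsTorsionFree A (M ⧸ S)] :
    IsTorsionFree A (S' ⧸ S.submoduleOf S') :=
  (LinearMap.ker_eq_bot.mp (S.ker_mapQ_submoduleOf S')).moduleIsTorsionFree _
    (fun _ _ => map_smul _ _ _)

/-- A countable torsion-free module over a Dedekind domain is free of infinite rank if it is not
finitely generated, but all its submodules of finite rank are. -/
theorem IsDedekindDomain.nonempty_finsupp_equiv {A M : Type*} [CommRing A] [IsDedekindDomain A]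
    [AddCommGroup M] [Module A M] [IsTorsionFree A M] [Countable M] (hfin : ¬ Module.Finite A M)
    (hM : ∀ T : Finset M, ∃ S : Submodule A M, S.FG ∧ (T : Set M) ⊆ S ∧ IsTorsionFree A (M ⧸ S)) :
    Nonempty (M ≃ₗ[A] (ℕ →₀ A)) := by
  classical
  obtain ⟨e, he⟩ := exists_surjective_nat M
  let X := {S : Submodule A M // S.FG ∧ IsTorsionFree A (M ⧸ S)}
  -- Adjoining m makes the chain exhaustive; adjoining some z outside S makes it strict.
  have step : ∀ (S : X) (m : M), ∃ S' : X, S.1 < S'.1 ∧ m ∈ S'.1 := by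
    rintro ⟨S, ⟨T, rfl⟩, hS⟩ m
    obtain ⟨z, hz⟩ : ∃ z, z ∉ Submodule.span A (T : Set M) := by
      by_contra! h
      exact hfin ⟨⟨T, (Submodule.eq_top_iff').mpr h⟩⟩
    obtain ⟨S', hfg, hle, htf⟩ := hM (insert m (insert z T))
    simp only [Finset.coe_insert, Set.insert_subset_iff, SetLike.mem_coe] at hle
    exact ⟨⟨S', hfg, htf⟩, lt_of_le_not_ge (Submodule.span_le.mpr hle.2.2) fun h => hz (h hle.2.1),
      hle.1⟩
  choose next hlt hmem using step
  have hbot : IsTorsionFree A (M ⧸ (⊥ : Submodule A M)) :=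
    (Submodule.quotEquivOfEqBot ⊥ rfl).injective.moduleIsTorsionFree _ (fun _ _ => map_smul _ _ _)
  let T : ℕ → X := fun n => Nat.rec ⟨⊥, Submodule.fg_bot, hbot⟩ (fun n S => next S (e n)) n
  have hT : StrictMono fun n => (T n).1 := strictMono_nat_of_lt_succ fun n => hlt (T n) (e n)
  -- Only every second term of the chain is kept: the skipped term `T (2 * n + 1)` lies strictly
  -- between and shows that each graded piece has rank at least two.
  let S : ℕ → Submodule A M := fun n => (T (2 * n)).1
  have htf : ∀ n, IsTorsionFree A (S (n + 1) ⧸ (S n).submoduleOf (S (n + 1))) := fun n => by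
    have := (T (2 * n)).2.2
    exact Submodule.isTorsionFree_quotient_submoduleOf _ _
  have hfg : ∀ n, Module.Finite A (S (n + 1)) := fun n =>
    Module.Finite.iff_fg.mpr (T (2 * (n + 1))).2.1
  have hproj : ∀ n, Projective A (S (n + 1) ⧸ (S n).submoduleOf (S (n + 1))) := fun n =>
    projective_of_isTorsionFree A _
  obtain ⟨Φ⟩ := Submodule.nonempty_directSum_quotient_equiv S
    (fun m n h => hT.monotone (by omega)) rfl (fun x => by
      obtain ⟨n, rfl⟩ := he x
      exact ⟨n + 1, hT.monotone (show n + 1 ≤ 2 * (n + 1) by omega) (hmem (T n) (e n))⟩)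
  have hdual : ∀ n, ∃ f : (S (n + 1) ⧸ (S n).submoduleOf (S (n + 1))) →ₗ[A] A,
      Function.Surjective f := fun n => by
    have := (T (2 * n + 1)).2.2
    have hle : S n ≤ (T (2 * n + 1)).1 := hT.monotone (Nat.le_succ _)
    refine exists_surjective_dual ((S n).submoduleOf (S (n + 1)) |>.mapQ (T (2 * n + 1)).1
      (S (n + 1)).subtype fun x hx => hle hx) ?_ ?_
    · obtain ⟨x, hx, hx'⟩ := SetLike.exists_of_lt (hT (Nat.lt_succ_self (2 * n)))
      have hx1 : x ∈ S (n + 1) := hT.monotone (show 2 * n + 1 ≤ 2 * (n + 1) by omega) hx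
      refine (Submodule.ne_bot_iff _).mpr ⟨Submodule.Quotient.mk ⟨x, hx1⟩, ?_, fun h => hx' ?_⟩
      · exact (Submodule.Quotient.mk_eq_zero _).mpr hx
      · exact (Submodule.Quotient.mk_eq_zero ((S n).submoduleOf (S (n + 1)))).mp h
    · obtain ⟨x, hx, hx'⟩ := SetLike.exists_of_lt (hT (Nat.lt_succ_self (2 * n + 1)))
      intro h
      have := congr($h (Submodule.Quotient.mk ⟨x, hx⟩))
      exact hx' ((Submodule.Quotient.mk_eq_zero _).mp this)
  choose f hf using hdual
  let g : M →ₗ[A] (ℕ →₀ A) := (finsuppLequivDFinsupp A).symm.toLinearMap.comp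
    ((DFinsupp.mapRange.linearMap f).comp Φ.symm.toLinearMap)
  have hg : Function.Surjective g := (finsuppLequivDFinsupp A).symm.surjective.comp
    ((DFinsupp.mapRange_surjective _ (fun i => map_zero (f i))).mpr hf |>.comp Φ.symm.surjective)
  have hMproj : Projective A M := .of_equiv Φ
  obtain ⟨s, hs⟩ := g.exists_rightInverse_of_surjective (LinearMap.range_eq_top.mpr hg)
  let E : (LinearMap.ker g × (ℕ →₀ A)) ≃ₗ[A] M :=
    lequivProdOfRightSplitExact (j := (LinearMap.ker g).subtype)
      (LinearMap.ker g).injective_subtype (by simp) hs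
  have hker : Projective A (LinearMap.ker g) := by
    refine .of_split (E.toLinearMap.comp (LinearMap.inl A _ _))
      ((LinearMap.fst A _ _).comp E.symm.toLinearMap) ?_
    ext x
    simp
  -- M is the sum of this projective countable kernel and A^(ℕ), so the swindle applies.
  obtain ⟨E'⟩ := Projective.nonempty_prod_finsupp_equiv A (LinearMap.ker g)
  exact ⟨E.symm.trans E'⟩

end DedekindModules

/-! ### Heights and descent over 𝔽[X]. -/

section Heights

open Polynomial Module

/-- A height on a module over `𝔽[X]`: an ultrametric function which is strictly increased by
multiplication by `X`. -/
structure IsModuleHeight (𝔽 : Type*) [Field 𝔽] {S : Type*} [AddCommGroup S] [Module 𝔽[X] S]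
    (h : S → ℕ) : Prop where
  sub_le : ∀ x y, h (x - y) ≤ max (h x) (h y)
  lt_X_smul : ∀ x, x ≠ 0 → h x < h ((X : 𝔽[X]) • x)

namespace IsModuleHeight

variable {𝔽 : Type*} [Field 𝔽] {S : Type*} [AddCommGroup S] [Module 𝔽[X] S] {h : S → ℕ}

theorem X_smul_eq_zero (hh : IsModuleHeight 𝔽 h) {x : S} (hx : (X : 𝔽[X]) • x = 0) : x = 0 := by
  by_contra hne
  have h1 := hh.lt_X_smul x hne
  have h2 : h ((X : 𝔽[X]) • x) ≤ h x := by
    rw [hx, ← sub_self x]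
    simpa using hh.sub_le x x
  omega

/-- Reducing a relation modulo XS kills its constant coefficients, and injectivity of X allows
division by X. Iterating, every coefficient is divisible by all powers of X. -/
theorem linearIndependent_of_mkQ [Module 𝔽 S] [IsScalarTower 𝔽 𝔽[X] S]
    (hX : ∀ x : S, (X : 𝔽[X]) • x = 0 → x = 0) {ι : Type*} [Finite ι] {v : ι → S}
    (hv : LinearIndependent 𝔽
      ((LinearMap.range (Algebra.lsmul 𝔽 𝔽 S (X : 𝔽[X]))).mkQ ∘ v)) :
    LinearIndependent 𝔽[X] v := by
  have := Fintype.ofFinite ι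
  rw [Fintype.linearIndependent_iff] at hv ⊢
  have key : ∀ n : ℕ, ∀ g : ι → 𝔽[X], ∑ i, g i • v i = 0 → ∀ i, (X : 𝔽[X]) ^ n ∣ g i := by
    intro n
    induction n with
    | zero => simp
    | succ n ih =>
      intro g hg
      have hdecomp : (X : 𝔽[X]) • ∑ i, (g i).divX • v i + ∑ i, (g i).coeff 0 • v i = 0 := by
        rw [← hg, Finset.smul_sum, ← Finset.sum_add_distrib]
        refine Finset.sum_congr rfl fun i _ => ?_
        conv_rhs => rw [← X_mul_divX_add (g i)]
        rw [add_smul, mul_smul, ← algebraMap_eq, algebraMap_smul]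
      have h0 : ∀ i, (g i).coeff 0 = 0 := by
        refine hv _ ?_
        have hsum : ∑ i, (g i).coeff 0 • v i ∈
            LinearMap.range (Algebra.lsmul 𝔽 𝔽 S (X : 𝔽[X])) := by
          refine ⟨-∑ i, (g i).divX • v i, ?_⟩
          change (X : 𝔽[X]) • -∑ i, (g i).divX • v i = _
          rw [smul_neg, eq_comm]
          exact eq_neg_of_add_eq_zero_right hdecomp
        rw [← (Submodule.Quotient.mk_eq_zero _).mpr hsum, ← Submodule.mkQ_apply, map_sum]
        exact Finset.sum_congr rfl fun i _ => (map_smul _ _ _).symm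
      simp only [h0, zero_smul, Finset.sum_const_zero, add_zero] at hdecomp
      intro i
      obtain ⟨r, hr⟩ := ih _ (hX _ hdecomp) i
      refine ⟨r, ?_⟩
      conv_lhs => rw [← X_mul_divX_add (g i), h0, C_0, add_zero, hr]
      ring
  intro g hg i
  ext d
  exact X_pow_dvd_iff.mp (key (d + 1) g hg i) d (Nat.lt_succ_self d)

/-- Independent vectors of S/XS lift to independent vectors of S, so the dimension of S/XS over the
finite field 𝔽 is at most the rank of S. -/
theorem finite_quotient [Finite 𝔽] [Module 𝔽 S] [IsScalarTower 𝔽 𝔽[X] S]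
    (hX : ∀ x : S, (X : 𝔽[X]) • x = 0 → x = 0) (hrank : Module.rank 𝔽[X] S < Cardinal.aleph0) :
    Finite (S ⧸ LinearMap.range (Algebra.lsmul 𝔽 𝔽 S (X : 𝔽[X]))) := by
  have : Module.rank 𝔽 (S ⧸ LinearMap.range (Algebra.lsmul 𝔽 𝔽 S (X : 𝔽[X]))) ≤
      finrank 𝔽[X] S := by
    refine rank_le fun s hs => ?_
    choose v hv using fun i : s => Submodule.mkQ_surjective _ i.1
    have hli : LinearIndependent 𝔽[X] v := linearIndependent_of_mkQ hX (by
      convert hs using 1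
      exact funext hv)
    have := hli.cardinal_le_rank
    have hcast : (finrank 𝔽[X] S : Cardinal) = Module.rank 𝔽[X] S :=
      Cardinal.cast_toNat_of_lt_aleph0 hrank
    rw [← hcast] at this
    simpa using this
  have : Module.Finite 𝔽 (S ⧸ LinearMap.range (Algebra.lsmul 𝔽 𝔽 S (X : 𝔽[X]))) :=
    Module.rank_lt_aleph0_iff.mp (this.trans_lt (Cardinal.natCast_lt_aleph0))
  exact Module.finite_of_finite 𝔽

/-- Two elements of a ball in the same class modulo X differ by some X • y, and y lies in a strictly
smaller ball unless it is zero. With finitely many classes, induction on the radius applies. -/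
theorem finite_setOf_le_of_finite_quotient [Module 𝔽 S] [IsScalarTower 𝔽 𝔽[X] S]
    (hh : IsModuleHeight 𝔽 h)
    [Finite (S ⧸ LinearMap.range (Algebra.lsmul 𝔽 𝔽 S (X : 𝔽[X])))] (c : ℕ) :
    {x | h x ≤ c}.Finite := by
  induction c using Nat.strong_induction_on with
  | _ c ih =>
    have hlt : {x | h x < c}.Finite := by
      cases c with
      | zero => simp
      | succ c => simpa only [Nat.lt_succ_iff] using ih c (Nat.lt_succ_self c)
    refine Set.Finite.of_finite_fibers
      (LinearMap.range (Algebra.lsmul 𝔽 𝔽 S (X : 𝔽[X]))).mkQ (Set.toFinite _) fun q _ => ?_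
    rcases Set.eq_empty_or_nonempty
      ({x | h x ≤ c} ∩ (LinearMap.range (Algebra.lsmul 𝔽 𝔽 S (X : 𝔽[X]))).mkQ ⁻¹' {q})
      with he | ⟨x₀, hx₀, rfl⟩
    · rw [he]
      exact Set.finite_empty
    refine ((hlt.union (Set.finite_singleton 0)).image fun y => (X : 𝔽[X]) • y + x₀).subset ?_
    rintro x ⟨hx, hxx⟩
    obtain ⟨y, hy⟩ := (Submodule.Quotient.eq _).mp hxx
    rw [Algebra.lsmul_coe] at hy
    refine ⟨y, ?_, by simp [hy]⟩
    by_cases hy0 : y = 0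
    · exact Or.inr hy0
    · have h1 := hh.lt_X_smul y hy0
      have h2 := hh.sub_le x x₀
      rw [← hy] at h2
      exact Or.inl (h1.trans_le (h2.trans (max_le hx hx₀)))

/-- Descent: subtract a representative modulo X and divide by X. This lowers any height above the
bound C on the representatives, so the finite ball of radius C generates. -/
theorem finite_of_finite_quotient [Module 𝔽 S] [IsScalarTower 𝔽 𝔽[X] S] (hh : IsModuleHeight 𝔽 h)
    [Finite (S ⧸ LinearMap.range (Algebra.lsmul 𝔽 𝔽 S (X : 𝔽[X])))] :
    Module.Finite 𝔽[X] S := by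
  choose r hr using Submodule.mkQ_surjective (LinearMap.range (Algebra.lsmul 𝔽 𝔽 S (X : 𝔽[X])))
  obtain ⟨C, hC⟩ := (Set.finite_range fun q => h (r q)).bddAbove
  rw [mem_upperBounds, Set.forall_mem_range] at hC
  have hfin := hh.finite_setOf_le_of_finite_quotient C
  refine ⟨⟨hfin.toFinset, Submodule.eq_top_iff'.mpr ?_⟩⟩
  rw [hfin.coe_toFinset]
  intro x
  induction hn : h x using Nat.strong_induction_on generalizing x with
  | _ n ih =>
    by_cases hx : h x ≤ C
    · exact Submodule.subset_span hx
    obtain ⟨y, hy⟩ := (Submodule.Quotient.eq _).mp (hr (Submodule.mkQ _ x)).symm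
    rw [Algebra.lsmul_coe] at hy
    rw [← sub_add_cancel x (r (Submodule.mkQ _ x)), ← hy]
    refine add_mem (Submodule.smul_mem _ _ ?_) (Submodule.subset_span (hC _))
    by_cases hy0 : y = 0
    · exact hy0 ▸ zero_mem _
    · have h1 := hh.lt_X_smul y hy0
      have h2 := hh.sub_le x (r (Submodule.mkQ _ x))
      rw [← hy] at h2
      dsimp only at h2
      have h3 := hC (Submodule.mkQ _ x)
      exact ih (h y) (by omega) y rfl

theorem finite_setOf_le [Finite 𝔽] (hh : IsModuleHeight 𝔽 h)
    (hrank : Module.rank 𝔽[X] S < Cardinal.aleph0) (c : ℕ) : {x | h x ≤ c}.Finite := by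
  let _ : Module 𝔽 S := Module.compHom S (C : 𝔽 →+* 𝔽[X])
  have : IsScalarTower 𝔽 𝔽[X] S := ⟨fun a p x => by
    rw [Polynomial.smul_eq_C_mul, mul_smul]
    rfl⟩
  have := finite_quotient (𝔽 := 𝔽) (fun _ => hh.X_smul_eq_zero) hrank
  exact hh.finite_setOf_le_of_finite_quotient c

theorem module_finite [Finite 𝔽] (hh : IsModuleHeight 𝔽 h)
    (hrank : Module.rank 𝔽[X] S < Cardinal.aleph0) : Module.Finite 𝔽[X] S := by
  let _ : Module 𝔽 S := Module.compHom S (C : 𝔽 →+* 𝔽[X])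
  have : IsScalarTower 𝔽 𝔽[X] S := ⟨fun a p x => by
    rw [Polynomial.smul_eq_C_mul, mul_smul]
    rfl⟩
  have := finite_quotient (𝔽 := 𝔽) (fun _ => hh.X_smul_eq_zero) hrank
  exact hh.finite_of_finite_quotient

theorem comp {S' : Type*} [AddCommGroup S'] [Module 𝔽[X] S'] (hh : IsModuleHeight 𝔽 h)
    (f : S' →ₗ[𝔽[X]] S) (hf : Function.Injective f) : IsModuleHeight 𝔽 (h ∘ f) where
  sub_le x y := by
    rw [Function.comp_apply, map_sub]
    exact hh.sub_le _ _
  lt_X_smul x hx := by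
    rw [Function.comp_apply, Function.comp_apply, map_smul]
    exact hh.lt_X_smul _ (fun h => hx (hf (h.trans (map_zero f).symm)))

/-- The heights of X^n • x increase strictly, so these elements are infinitely many. If p • x = 0,
they only depend on X^n modulo p, which takes finitely many values. -/
theorem isTorsionFree [Finite 𝔽] (hh : IsModuleHeight 𝔽 h) : IsTorsionFree 𝔽[X] S := by
  refine .of_smul_eq_zero fun p x hpx => ?_
  by_contra! hne
  obtain ⟨hp, hx⟩ := hne
  have hpow : ∀ n : ℕ, (X : 𝔽[X]) ^ n • x ≠ 0 := by
    intro n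
    induction n with
    | zero => simpa using hx
    | succ n ih =>
      rw [pow_succ', mul_smul]
      exact fun h => ih (hh.X_smul_eq_zero h)
  have hmono : StrictMono fun n : ℕ => h ((X : 𝔽[X]) ^ n • x) :=
    strictMono_nat_of_lt_succ fun n => by
      rw [pow_succ', mul_smul]
      exact hh.lt_X_smul _ (hpow n)
  have hinj : Function.Injective fun n : ℕ => (X : 𝔽[X]) ^ n • x :=
    Function.Injective.of_comp (f := h) hmono.injective
  have : Module.Finite 𝔽 (degreeLT 𝔽 p.natDegree) :=
    Module.Finite.equiv (degreeLTEquiv 𝔽 p.natDegree).symm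
  have : Finite (degreeLT 𝔽 p.natDegree) := Module.finite_of_finite 𝔽
  refine Set.infinite_range_of_injective hinj
    ((Set.finite_range fun r : degreeLT 𝔽 p.natDegree => (r : 𝔽[X]) • x).subset ?_)
  rintro _ ⟨n, rfl⟩
  refine ⟨⟨X ^ n % p, mem_degreeLT.mpr ?_⟩, ?_⟩
  · rw [← degree_eq_natDegree hp]
    exact EuclideanDomain.mod_lt _ hp
  · have := EuclideanDomain.div_add_mod (X ^ n : 𝔽[X]) p
    change (X ^ n % p) • x = X ^ n • x
    conv_rhs => rw [← this, add_smul, mul_comm, mul_smul, hpx, smul_zero, zero_add]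

variable {A : Type*} [CommRing A] [IsDomain A] [Algebra 𝔽[X] A] [Module A S]
  [IsScalarTower 𝔽[X] A S]

theorem isTorsionFree_of_isAlgebraic [Finite 𝔽] (hh : IsModuleHeight 𝔽 h)
    [Algebra.IsAlgebraic 𝔽[X] A] : IsTorsionFree A S := by
  have := hh.isTorsionFree
  refine .of_smul_eq_zero fun a x hax => ?_
  by_contra! hne
  obtain ⟨p, hp, b, hb⟩ := (Algebra.IsAlgebraic.isAlgebraic (R := 𝔽[X]) a).exists_nonzero_dvd
    (mem_nonZeroDivisors_of_ne_zero hne.1)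
  have : p • x = 0 := by rw [← algebraMap_smul A, hb, mul_comm, mul_smul, hax, smul_zero]
  exact (smul_ne_zero hp hne.2) this

/-- For x ≠ 0 the orbit map a ↦ a • x embeds A into S, so A inherits a height. -/
theorem finite_ring [Finite 𝔽] [Nontrivial S] (hh : IsModuleHeight 𝔽 h)
    [Algebra.IsAlgebraic 𝔽[X] A] (hrank : Module.rank 𝔽[X] A < Cardinal.aleph0) :
    Module.Finite 𝔽[X] A := by
  have := hh.isTorsionFree_of_isAlgebraic (A := A)
  obtain ⟨x, hx⟩ := exists_ne (0 : S)
  exact (hh.comp ((LinearMap.toSpanSingleton A S x).restrictScalars 𝔽[X])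
    (smul_left_injective A hx)).module_finite hrank

theorem isDedekindDomain [Module.Finite 𝔽[X] A] [IsIntegrallyClosed A] : IsDedekindDomain A where
  __ := (inferInstance : IsDomain A)
  __ := IsNoetherianRing.of_finite 𝔽[X] A
  __ := Ring.DimensionLEOne.of_isIntegral 𝔽[X] A
  __ := (inferInstance : IsIntegrallyClosed A)

/-- N is the saturation of the span of T. It has the same finite rank over 𝔽[X] as the span, so the
height makes it finitely generated. -/
theorem exists_fg_isTorsionFree_quotient [Finite 𝔽] (hh : IsModuleHeight 𝔽 h)
    [Algebra.IsAlgebraic 𝔽[X] A] [Module.Finite 𝔽[X] A] (T : Finset S) :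
    ∃ N : Submodule A S, N.FG ∧ (T : Set S) ⊆ N ∧ IsTorsionFree A (S ⧸ N) := by
  set N₀ := Submodule.span A (T : Set S) with hN₀
  let N := (Submodule.torsion A (S ⧸ N₀)).comap N₀.mkQ
  have hmem : ∀ x, x ∈ N ↔ ∃ a : A, a ≠ 0 ∧ a • x ∈ N₀ := fun x => by
    simp only [N, Submodule.mem_comap, Submodule.mem_torsion_iff, Submodule.mkQ_apply,
      ← Submodule.Quotient.mk_smul, Submodule.Quotient.mk_eq_zero]
    constructor
    · rintro ⟨a, ha⟩
      exact ⟨a, nonZeroDivisors.coe_ne_zero a, ha⟩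
    · rintro ⟨a, ha, hax⟩
      exact ⟨⟨a, mem_nonZeroDivisors_of_ne_zero ha⟩, hax⟩
  have hle : N₀ ≤ N := fun x hx => (hmem x).mpr ⟨1, one_ne_zero, by simpa using hx⟩
  refine ⟨N, ?_, Submodule.subset_span.trans hle, ?_⟩
  · have hN₀fin : Module.Finite A N₀ := Module.Finite.span_finset A T
    have : Module.Finite 𝔽[X] N₀ := Module.Finite.trans A N₀
    let N' := (Submodule.inclusion hle).restrictScalars 𝔽[X]
    have hquot : Module.rank 𝔽[X] (N ⧸ LinearMap.range N') = 0 := by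
      rw [rank_eq_zero_iff]
      intro q
      obtain ⟨⟨x, hx⟩, rfl⟩ := Submodule.mkQ_surjective _ q
      obtain ⟨a, ha, hax⟩ := (hmem x).mp hx
      obtain ⟨p, hp, b, hb⟩ := (Algebra.IsAlgebraic.isAlgebraic (R := 𝔽[X]) a).exists_nonzero_dvd
        (mem_nonZeroDivisors_of_ne_zero ha)
      refine ⟨p, hp, ?_⟩
      rw [← map_smul, Submodule.mkQ_apply, Submodule.Quotient.mk_eq_zero]
      have hpx : p • x ∈ N₀ := by
        rw [← algebraMap_smul A, hb, mul_comm, mul_smul]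
        exact N₀.smul_mem b hax
      exact ⟨⟨p • x, hpx⟩, rfl⟩
    have hrange : Module.Finite 𝔽[X] (LinearMap.range N') := Module.Finite.range N'
    have hrank : Module.rank 𝔽[X] N < Cardinal.aleph0 := by
      rw [← rank_quotient_add_rank_of_isDomain (LinearMap.range N'), hquot, zero_add]
      exact Module.rank_lt_aleph0 _ _
    have : Module.Finite 𝔽[X] N :=
      (hh.comp (N.subtype.restrictScalars 𝔽[X]) N.injective_subtype).module_finite hrank
    exact Module.Finite.iff_fg.mp (Module.Finite.of_restrictScalars_finite 𝔽[X] A N)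
  · refine .of_smul_eq_zero fun a q haq => ?_
    obtain ⟨x, rfl⟩ := Submodule.mkQ_surjective _ q
    rw [or_iff_not_imp_left]
    intro ha
    rw [← map_smul, Submodule.mkQ_apply, Submodule.Quotient.mk_eq_zero] at haq
    rw [Submodule.mkQ_apply, Submodule.Quotient.mk_eq_zero]
    obtain ⟨b, hb, hbx⟩ := (hmem _).mp haq
    exact (hmem x).mpr ⟨b * a, mul_ne_zero hb ha, by rwa [mul_smul]⟩

/-- A countable module with a height for which some ball is infinite is free. -/
theorem nonempty_finsupp_equiv [Finite 𝔽] [Countable S] (hh : IsModuleHeight 𝔽 h)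
    [IsIntegrallyClosed A] [Algebra.IsAlgebraic 𝔽[X] A]
    (hrank : Module.rank 𝔽[X] A < Cardinal.aleph0) (c : ℕ) (hc : {x | h x ≤ c}.Infinite) :
    Nonempty (S ≃ₗ[A] (ℕ →₀ A)) := by
  have : Nontrivial S := by
    by_contra hS
    rw [not_nontrivial_iff_subsingleton] at hS
    exact hc (Set.toFinite _)
  have := hh.finite_ring hrank
  have := isDedekindDomain (𝔽 := 𝔽) (A := A)
  have := hh.isTorsionFree_of_isAlgebraic (A := A)
  -- If S were finite over A, it would have finite rank over 𝔽[X], and all balls would be finite.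
  refine IsDedekindDomain.nonempty_finsupp_equiv (fun hfin => hc ?_)
    hh.exists_fg_isTorsionFree_quotient
  have : Module.Finite 𝔽[X] S := Module.Finite.trans A S
  exact hh.finite_setOf_le (Module.rank_lt_aleph0 _ _) c

end IsModuleHeight

end Heights

/-! ### Discrete valuations on K and pole orders. -/

section PoleFamilies

open IsDedekindDomain WithZero IntermediateField
open scoped algebraAdjoinAdjoin

/-- A family of discrete valuations on `K`, trivial on `F`, such that each element of `K` has
finitely many poles. -/
structure IsPoleFamily (F : Type*) {K : Type*} [Field F] [Field K] [Algebra F K]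
    (V : Set (Valuation K ℤᵐ⁰)) : Prop where
  algebraMap_le_one : ∀ v ∈ V, ∀ c : F, v (algebraMap F K c) ≤ 1
  finite_poles : ∀ y : K, {v ∈ V | 1 < v y}.Finite

theorem IsPoleFamily.iUnion {F K : Type*} [Field F] [Field K] [Algebra F K] {ι : Type*}
    [Finite ι] {V : ι → Set (Valuation K ℤᵐ⁰)} (hV : ∀ i, IsPoleFamily F (V i)) :
    IsPoleFamily F (⋃ i, V i) where
  algebraMap_le_one v hv c := by
    obtain ⟨i, hi⟩ := Set.mem_iUnion.mp hv
    exact (hV i).algebraMap_le_one v hi c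
  finite_poles y := by
    refine (Set.finite_iUnion fun i => (hV i).finite_poles y).subset ?_
    rintro v ⟨hv, hy⟩
    obtain ⟨i, hi⟩ := Set.mem_iUnion.mp hv
    exact Set.mem_iUnion.mpr ⟨i, hi, hy⟩

theorem IsPoleFamily.of_isScalarTower {F L K : Type*} [Field F] [Field L] [Field K] [Algebra F L]
    [Algebra F K] [Algebra L K] [IsScalarTower F L K] {V : Set (Valuation K ℤᵐ⁰)}
    (hV : IsPoleFamily L V) : IsPoleFamily F V where
  algebraMap_le_one v hv c := by
    rw [IsScalarTower.algebraMap_apply F L K]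
    exact hV.algebraMap_le_one v hv _
  finite_poles := hV.finite_poles

/-- The integral closure of L in K is the intersection of the valuation rings containing it. -/
theorem ValuationSubring.exists_notMem_of_not_isAlgebraic {L K : Type*} [Field L] [Field K]
    [Algebra L K] {y : K} (hy : ¬ IsAlgebraic L y) :
    ∃ O : ValuationSubring K, (∀ c : L, algebraMap L K c ∈ O) ∧ y ∉ O := by
  rw [isAlgebraic_iff_isIntegral] at hy
  have : IsIntegrallyClosedIn (integralClosure L K).toSubring K :=
    Subring.isIntegrallyClosedIn_iff.mpr fun z hz => isIntegral_trans (A := integralClosure L K) z hz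
  obtain ⟨O, hO, hyO⟩ := Subring.exists_le_valuationSubring_of_isIntegrallyClosedIn
    (R := (integralClosure L K).toSubring) hy
  exact ⟨O, fun c => hO (isIntegral_algebraMap (R := L) (x := c)), hyO⟩

theorem ValuationSubring.mem_of_isIntegral_adjoin {L K : Type*} [Field L] [Field K]
    [Algebra L K] {O : ValuationSubring K} (hO : ∀ c : L, algebraMap L K c ∈ O) {x y : K}
    (hx : x ∈ O) (hy : IsIntegral (Algebra.adjoin L {x}) y) : y ∈ O := by
  have hle : ∀ z ∈ Algebra.adjoin L {x}, z ∈ O := fun z hz => by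
    induction hz using Algebra.adjoin_induction with
    | mem z hz => rwa [Set.mem_singleton_iff.mp hz]
    | algebraMap c => exact hO c
    | add _ _ _ _ h h' => exact O.add_mem _ _ h h'
    | mul _ _ _ _ h h' => exact O.mul_mem _ _ h h'
  have hint : IsIntegral O y :=
    hy.map_of_comp_eq (Subring.inclusion (S := (Algebra.adjoin L {x}).toSubring)
      (T := O.toSubring) hle) (RingHom.id K) rfl
  obtain ⟨z, hz⟩ := IsIntegrallyClosed.isIntegral_iff.mp hint
  rw [← hz]
  exact z.2

/-- L[x] is a principal ideal domain, so its integral closure in K is Dedekind with fraction field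
K. The valuations are those of its maximal ideals. -/
theorem exists_isPoleFamily_isIntegral {L K : Type*} [Field L] [Field K] [Algebra L K] {x : K}
    (hx : Transcendental L x) [FiniteDimensional L⟮x⟯ K] [Algebra.IsSeparable L⟮x⟯ K] :
    ∃ V : Set (Valuation K ℤᵐ⁰), IsPoleFamily L V ∧
      ∀ y, (∀ v ∈ V, v y ≤ 1) → IsIntegral (Algebra.adjoin L {x}) y := by
  have : IsPrincipalIdealRing (Algebra.adjoin L {x}) :=
    IsPrincipalIdealRing.of_surjective (Polynomial.algEquivOfTranscendental L x hx)
      (Polynomial.algEquivOfTranscendental L x hx).surjective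
  let R := integralClosure (Algebra.adjoin L {x}) K
  have : IsDedekindDomain R := integralClosure.isDedekindDomain (Algebra.adjoin L {x}) L⟮x⟯ K
  have : IsFractionRing R K := integralClosure.isFractionRing_of_finite_extension L⟮x⟯ K
  refine ⟨Set.range fun v : HeightOneSpectrum R => v.valuation K, ⟨?_, fun y => ?_⟩, fun y hy => ?_⟩
  · rintro _ ⟨v, rfl⟩ c
    exact v.valuation_le_one (algebraMap (Algebra.adjoin L {x}) R (algebraMap L _ c))
  · refine ((HeightOneSpectrum.Support.finite R y).image fun v => v.valuation K).subset ?_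
    rintro _ ⟨⟨v, rfl⟩, hv⟩
    exact ⟨v, hv, rfl⟩
  · obtain ⟨z, rfl⟩ := HeightOneSpectrum.mem_integers_of_valuation_le_one (R := R) K y
      fun v => hy _ ⟨v, rfl⟩
    exact z.2

/-- The charts L[x] and L[1/x] cover the curve: every valuation ring of K over L contains x or 1/x.
An element integral over both charts thus lies in all these rings, so it is algebraic over L. -/
theorem exists_isPoleFamily_isAlgebraic {L K : Type*} [Field L] [Field K] [Algebra L K] {x : K}
    (hx : Transcendental L x) [FiniteDimensional L⟮x⟯ K] [Algebra.IsSeparable L⟮x⟯ K] :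
    ∃ V : Set (Valuation K ℤᵐ⁰), IsPoleFamily L V ∧
      ∀ y, (∀ v ∈ V, v y ≤ 1) → IsAlgebraic L y := by
  have hxi : Transcendental L x⁻¹ := fun h => hx (by simpa using h.inv)
  have heq : L⟮x⁻¹⟯ = L⟮x⟯ := by
    refine le_antisymm ?_ ?_ <;> rw [adjoin_simple_le_iff]
    · exact inv_mem (mem_adjoin_simple_self L x)
    · simpa using inv_mem (mem_adjoin_simple_self L x⁻¹)
  have : FiniteDimensional L⟮x⁻¹⟯ K := by rwa [heq]
  have : Algebra.IsSeparable L⟮x⁻¹⟯ K := by rwa [heq]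
  obtain ⟨V₁, hV₁, h₁⟩ := exists_isPoleFamily_isIntegral hx
  obtain ⟨V₂, hV₂, h₂⟩ := exists_isPoleFamily_isIntegral hxi
  refine ⟨⋃ b : Bool, if b then V₁ else V₂, .iUnion (by simp [hV₁, hV₂]), fun y hy => ?_⟩
  by_contra hny
  obtain ⟨O, hO, hyO⟩ := ValuationSubring.exists_notMem_of_not_isAlgebraic hny
  rcases O.mem_or_inv_mem x with hxO | hxO
  · exact hyO (ValuationSubring.mem_of_isIntegral_adjoin hO hxO
      (h₁ y fun v hv => hy v (Set.mem_iUnion.mpr ⟨true, by simpa using hv⟩)))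
  · exact hyO (ValuationSubring.mem_of_isIntegral_adjoin hO hxO
      (h₂ y fun v hv => hy v (Set.mem_iUnion.mpr ⟨false, by simpa using hv⟩)))

/-- In the matroid of algebraic independence, closure commutes with intersections of subsets of an
independent set, and the sets s \ {x} have empty intersection. -/
theorem isAlgebraic_of_forall_isAlgebraic_adjoin_diff {F K : Type*} [Field F] [Field K]
    [Algebra F K] {s : Set K} (hs : AlgebraicIndepOn F id s) (hne : s.Nonempty) {y : K}
    (hy : ∀ x ∈ s, IsAlgebraic (IntermediateField.adjoin F (s \ {x})) y) : IsAlgebraic F y := by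
  have := hne.coe_sort
  have hcl : y ∈ (AlgebraicIndependent.matroid F K).closure (⋂ x : s, s \ {x.1}) := by
    rw [Matroid.Indep.closure_iInter_eq_biInter_closure_of_forall_subset
      (AlgebraicIndependent.matroid_indep_iff.mpr hs) fun x => Set.sdiff_subset]
    refine Set.mem_iInter.mpr fun x => ?_
    rw [AlgebraicIndependent.matroid_closure_eq]
    exact (IsFractionRing.isAlgebraic_iff (Algebra.adjoin F (s \ {x.1}))
      (IntermediateField.adjoin F (s \ {x.1})) K).mpr (hy x x.2)
  have hempty : ⋂ x : s, s \ {x.1} = ∅ := by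
    refine Set.eq_empty_of_forall_notMem fun z hz => ?_
    rw [Set.mem_iInter] at hz
    exact (hz ⟨z, (hz ⟨_, hne.some_mem⟩).1⟩).2 rfl
  rw [hempty, AlgebraicIndependent.matroid_closure_eq] at hcl
  have h : IsAlgebraic (Algebra.adjoin F (∅ : Set K)) y := hcl
  rw [Algebra.adjoin_empty] at h
  exact (isAlgebraic_ringHom_iff_of_comp_eq (Algebra.botEquiv F K).symm (RingHom.id K)
    Function.injective_id rfl).mp h

/-- On a finitely generated extension of an algebraically closed field `F`, there are enough
discrete valuations to detect the elements outside `F`. -/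
theorem exists_isPoleFamily {F K : Type*} [Field F] [Field K] [Algebra F K] [IsAlgClosed F]
    [Algebra.EssFiniteType F K] (hK : ¬ Algebra.IsAlgebraic F K) :
    ∃ V : Set (Valuation K ℤᵐ⁰), IsPoleFamily F V ∧
      ∀ y, (∀ v ∈ V, v y ≤ 1) → y ∈ Set.range (algebraMap F K) := by
  obtain ⟨s, hs, hsep⟩ := exists_isTranscendenceBasis_and_isSeparable_of_perfectField F K
  have hne : (s : Set K).Nonempty := by
    by_contra h
    rw [Set.not_nonempty_iff_eq_empty, Finset.coe_eq_empty] at h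
    subst h
    exact hK (hs.isEmpty_iff_isAlgebraic.mp inferInstance)
  -- For each x in a separating transcendence basis s, K is a function field in the one variable x
  -- over F(s \ {x}).
  have key : ∀ x : s, ∃ V : Set (Valuation K ℤᵐ⁰), IsPoleFamily F V ∧
      ∀ y, (∀ v ∈ V, v y ≤ 1) →
        IsAlgebraic (IntermediateField.adjoin F ((s : Set K) \ {x.1})) y := by
    intro x
    set L := IntermediateField.adjoin F ((s : Set K) \ {x.1})
    have htr : Transcendental L x.1 := by
      have h := hs.1.transcendental_adjoin (s := {x}ᶜ) (i := x) (by simp)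
      have himg : ((↑) : s → K) '' {x}ᶜ = (s : Set K) \ {x.1} := by
        ext z
        constructor
        · rintro ⟨w, hw, rfl⟩
          exact ⟨w.2, fun h => hw (Subtype.ext h)⟩
        · rintro ⟨hz, hzx⟩
          exact ⟨⟨z, hz⟩, fun h => hzx (congrArg Subtype.val h), rfl⟩
      rw [himg] at h
      exact fun h' => h ((IsFractionRing.isAlgebraic_iff _ L K).mpr h')
    have hadj : L⟮x.1⟯.restrictScalars F = IntermediateField.adjoin F (s : Set K) := by
      rw [IntermediateField.adjoin_adjoin_left, Set.sdiff_union_self,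
        Set.union_eq_self_of_subset_right (Set.singleton_subset_iff.mpr x.2)]
    have hsep' : Algebra.IsSeparable (L⟮x.1⟯.restrictScalars F) K := by rwa [hadj]
    have : Algebra.IsSeparable L⟮x.1⟯ K := hsep'
    have : Algebra.EssFiniteType L K := Algebra.EssFiniteType.of_comp F L K
    have : Algebra.EssFiniteType L⟮x.1⟯ K := Algebra.EssFiniteType.of_comp L L⟮x.1⟯ K
    have : FiniteDimensional L⟮x.1⟯ K := Algebra.finite_of_essFiniteType_of_isAlgebraic
    obtain ⟨V, hV, h⟩ := exists_isPoleFamily_isAlgebraic htr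
    exact ⟨V, hV.of_isScalarTower, h⟩
  choose V hV hVy using key
  refine ⟨⋃ x, V x, .iUnion hV, fun y hy => ?_⟩
  have hyalg : IsAlgebraic F y := isAlgebraic_of_forall_isAlgebraic_adjoin_diff hs.1 hne
    fun x hx => hVy ⟨x, hx⟩ y fun v hv => hy v (Set.mem_iUnion.mpr ⟨_, hv⟩)
  exact minpoly.mem_range_of_degree_eq_one F y
    (IsAlgClosed.degree_eq_one_of_irreducible F (minpoly.irreducible hyalg.isIntegral))

namespace IsPoleFamily

variable {F K : Type*} [Field F] [Field K] [Algebra F K] {V : Set (Valuation K ℤᵐ⁰)}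

/-- The largest pole order. -/
noncomputable def height (hV : IsPoleFamily F V) (y : K) : ℕ :=
  (hV.finite_poles y).toFinset.sup fun v => (log (v y)).toNat

theorem log_toNat_le_height (hV : IsPoleFamily F V) {v : Valuation K ℤᵐ⁰} (hv : v ∈ V) (y : K) :
    (log (v y)).toNat ≤ hV.height y := by
  by_cases h : 1 < v y
  · exact Finset.le_sup (f := fun v : Valuation K ℤᵐ⁰ => (log (v y)).toNat)
      ((hV.finite_poles y).mem_toFinset.mpr ⟨hv, h⟩)
  -- Here `log 0 = 0` by convention, so a zero of y contributes pole order 0.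
  · by_cases h0 : v y = 0
    · simp [h0]
    · have : log (v y) ≤ log 1 := (log_le_log h0 one_ne_zero).mpr (not_lt.mp h)
      rw [log_one] at this
      rw [Int.toNat_eq_zero.mpr this]
      exact Nat.zero_le _

theorem height_le_iff (hV : IsPoleFamily F V) {y : K} {n : ℕ} :
    hV.height y ≤ n ↔ ∀ v ∈ V, v y ≤ exp (n : ℤ) := by
  constructor
  · intro h v hv
    by_cases h0 : v y = 0
    · simp [h0]
    · rw [← log_le_iff_le_exp h0, ← Int.toNat_le]
      exact (hV.log_toNat_le_height hv y).trans h
  · intro h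
    refine Finset.sup_le fun v hv => ?_
    obtain ⟨hv, hy⟩ := (hV.finite_poles y).mem_toFinset.mp hv
    rw [Int.toNat_le, log_le_iff_le_exp (ne_zero_of_lt hy)]
    exact h v hv

theorem height_sub_le (hV : IsPoleFamily F V) (x y : K) :
    hV.height (x - y) ≤ max (hV.height x) (hV.height y) :=
  hV.height_le_iff.mpr fun v hv => (v.map_sub x y).trans (max_le
    (hV.height_le_iff.mp (le_max_left _ _) v hv) (hV.height_le_iff.mp (le_max_right _ _) v hv))

theorem height_eq_zero_iff (hV : IsPoleFamily F V) {y : K} :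
    hV.height y = 0 ↔ ∀ v ∈ V, v y ≤ 1 := by
  rw [← Nat.le_zero, height_le_iff]
  simp

theorem height_algebraMap (hV : IsPoleFamily F V) (c : F) : hV.height (algebraMap F K c) = 0 :=
  hV.height_eq_zero_iff.mpr fun v hv => hV.algebraMap_le_one v hv c

theorem height_algebraMap_mul_le (hV : IsPoleFamily F V) (c : F) (y : K) :
    hV.height (algebraMap F K c * y) ≤ hV.height y :=
  hV.height_le_iff.mpr fun v hv => by
    rw [map_mul]
    exact (mul_le_of_le_one_left' (hV.algebraMap_le_one v hv c)).trans
      (hV.height_le_iff.mp le_rfl v hv)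

theorem exists_log_eq_height (hV : IsPoleFamily F V) {y : K} (hy : hV.height y ≠ 0) :
    ∃ v ∈ V, 1 < v y ∧ (log (v y)).toNat = hV.height y := by
  have hne : (hV.finite_poles y).toFinset.Nonempty := by
    by_contra h
    rw [Finset.not_nonempty_iff_eq_empty] at h
    exact hy (by rw [height, h, Finset.sup_empty, Nat.bot_eq_zero])
  obtain ⟨v, hv, h⟩ := Finset.exists_mem_eq_sup _ hne fun v : Valuation K ℤᵐ⁰ => (log (v y)).toNat
  obtain ⟨hv, hy⟩ := (hV.finite_poles y).mem_toFinset.mp hv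
  exact ⟨v, hv, hy, h.symm⟩

theorem map_algebraMap_eq_one (hV : IsPoleFamily F V) {v : Valuation K ℤᵐ⁰} (hv : v ∈ V) {c : F}
    (hc : c ≠ 0) : v (algebraMap F K c) = 1 := by
  refine le_antisymm (hV.algebraMap_le_one v hv c) ?_
  have h := hV.algebraMap_le_one v hv c⁻¹
  have hc' : algebraMap F K c ≠ 0 := by simpa using hc
  rw [map_inv₀, map_inv₀] at h
  exact (inv_le_one₀ (zero_lt_iff.mpr ((v.ne_zero_iff).mpr hc'))).mp h

/-- Polynomials with exponents bigger than one increase the height. -/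
theorem height_lt_height_sum (hV : IsPoleFamily F V) {y : K} (hy : hV.height y ≠ 0) (s : Finset ℕ)
    {c : ℕ → F} (hc : ∀ n ∈ s, c n ≠ 0) {e : ℕ → ℕ} (he : StrictMono e) {m : ℕ} (hm : m ∈ s)
    (hem : 1 < e m) : hV.height y < hV.height (∑ n ∈ s, algebraMap F K (c n) * y ^ e n) := by
  classical
  obtain ⟨v, hv, hvy, heq⟩ := hV.exists_log_eq_height hy
  set N := s.max' ⟨m, hm⟩
  have hN : N ∈ s := s.max'_mem _
  have heN : 1 < e N := hem.trans_le (he.monotone (s.le_max' m hm))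
  have hterm : ∀ n ∈ s, v (algebraMap F K (c n) * y ^ e n) = v y ^ e n := fun n hn => by
    rw [map_mul, map_pow, hV.map_algebraMap_eq_one hv (hc n hn), one_mul]
  -- At a pole of y the terms have distinct values, so the largest exponent dominates and multiplies
  -- the pole order by e N > 1.
  have hval : v (∑ n ∈ s, algebraMap F K (c n) * y ^ e n) = v y ^ e N := by
    rw [← Finset.add_sum_erase s _ hN, v.map_add_eq_of_lt_left, hterm N hN]
    rw [hterm N hN]
    refine v.map_sum_lt (pow_ne_zero _ (ne_zero_of_lt hvy)) fun n hn => ?_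
    rw [hterm n (Finset.mem_of_mem_erase hn)]
    exact pow_lt_pow_right₀ hvy (he (lt_of_le_of_ne (s.le_max' _ (Finset.mem_of_mem_erase hn))
      (Finset.ne_of_mem_erase hn)))
  refine lt_of_lt_of_le ?_ (hV.log_toNat_le_height hv _)
  rw [hval, log_pow, ← heq]
  have hpos : 0 < (log (v y)).toNat := by omega
  have h2 : ((log (v y)).toNat : ℤ) = log (v y) := Int.toNat_of_nonneg (by omega)
  rw [← h2, nsmul_eq_mul, ← Nat.cast_mul, Int.toNat_natCast, Int.toNat_natCast]
  exact lt_mul_of_one_lt_left hpos heN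

end IsPoleFamily

end PoleFamilies

/-! ### The coordinate ring A and its function field. -/

section FunctionField

open Polynomial Module

/-- The image of X is transcendental over Fq and k has transcendence degree 1, so k is finite over
Fq(X); A embeds in k. -/
theorem Subalgebra.isAlgebraic_and_rank_lt_aleph0 {Fq k : Type*} [Field Fq] [Field k] [Algebra Fq k]
    [Algebra.EssFiniteType Fq k] (hk : Algebra.trdeg Fq k = 1) (A : Subalgebra Fq k)
    [Algebra Fq[X] A] [IsScalarTower Fq Fq[X] A]
    (hinj : Function.Injective (algebraMap Fq[X] A)) :
    Algebra.IsAlgebraic Fq[X] A ∧ Module.rank Fq[X] A < Cardinal.aleph0 := by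
  let _ : Algebra Fq[X] k := ((algebraMap A k).comp (algebraMap Fq[X] A)).toAlgebra
  have hk_inj : Function.Injective (algebraMap Fq[X] k) := Subtype.val_injective.comp hinj
  have : FaithfulSMul Fq[X] k := (faithfulSMul_iff_algebraMap_injective _ _).mpr hk_inj
  have : IsScalarTower Fq[X] A k := .of_algebraMap_eq' rfl
  have : IsScalarTower Fq Fq[X] k := .of_algebraMap_eq' (by
    rw [IsScalarTower.algebraMap_eq Fq A k, IsScalarTower.algebraMap_eq Fq Fq[X] A]
    rfl)
  let E := FractionRing Fq[X]
  let _ : Algebra E k := FractionRing.liftAlgebra Fq[X] k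
  have : IsScalarTower Fq[X] E k := FractionRing.isScalarTower_liftAlgebra Fq[X] k
  have : IsScalarTower Fq E k := .of_algebraMap_eq' (by
    rw [IsScalarTower.algebraMap_eq Fq Fq[X] k, IsScalarTower.algebraMap_eq Fq Fq[X] E,
      IsScalarTower.algebraMap_eq Fq[X] E k, RingHom.comp_assoc])
  have htr : Algebra.trdeg Fq[X] k = 0 := by
    have h := lift_trdeg_add_eq Fq Fq[X] k
    rw [Polynomial.trdeg_of_isDomain, hk, Cardinal.lift_one, Cardinal.lift_one] at h
    exact Cardinal.lift_eq_zero.mp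
      (Cardinal.eq_of_add_eq_add_left (h.trans (add_zero 1).symm) Cardinal.one_lt_aleph0)
  have halg : Algebra.IsAlgebraic Fq[X] k := trdeg_eq_zero_iff.mp htr
  have : Algebra.IsAlgebraic E k := (IsFractionRing.comap_isAlgebraic_iff (A := Fq[X])).mp halg
  have : Algebra.EssFiniteType E k := Algebra.EssFiniteType.of_comp Fq E k
  have : FiniteDimensional E k := Algebra.finite_of_essFiniteType_of_isAlgebraic
  constructor
  · exact Algebra.IsAlgebraic.of_injective (IsScalarTower.toAlgHom Fq[X] A k) Subtype.val_injective
  · refine (LinearMap.rank_le_of_injective (IsScalarTower.toAlgHom Fq[X] A k).toLinearMap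
      Subtype.val_injective).trans_lt ?_
    rw [← IsLocalization.rank_eq E (nonZeroDivisors Fq[X]) le_rfl]
    exact Module.rank_lt_aleph0 E k

/-- A is cut out in k by valuation rings, each integrally closed. -/
theorem isIntegrallyClosed_ringRegularAwayFrom {Fq k : Type*} [Field Fq] [Field k] [Algebra Fq k]
    (pt : ClosedPoint Fq k) : IsIntegrallyClosed (ringRegularAwayFrom pt) := by
  let A := ringRegularAwayFrom pt
  have hinj : Function.Injective (algebraMap A k) := Subtype.val_injective
  have : FaithfulSMul A k := (faithfulSMul_iff_algebraMap_injective _ _).mpr hinj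
  let _ : Algebra (FractionRing A) k := FractionRing.liftAlgebra A k
  have : IsScalarTower A (FractionRing A) k := FractionRing.isScalarTower_liftAlgebra A k
  refine (isIntegrallyClosed_iff (FractionRing A)).mpr fun {x} hx => ?_
  have hxk : IsIntegral A (algebraMap (FractionRing A) k x) := hx.algebraMap
  have hmem : algebraMap (FractionRing A) k x ∈ A := fun P hP => by
    have hint : IsIntegral P.localRing (algebraMap (FractionRing A) k x) :=
      hxk.map_of_comp_eq (Subring.inclusion (S := A.toSubring) (T := P.localRing.toSubring)
        fun y hy => hy P hP) (RingHom.id k) rfl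
    obtain ⟨z, hz⟩ := IsIntegrallyClosed.isIntegral_iff.mp hint
    rw [← hz]
    exact z.2
  refine ⟨⟨_, hmem⟩, (algebraMap (FractionRing A) k).injective ?_⟩
  rw [← IsScalarTower.algebraMap_apply]
  rfl

theorem IntermediateField.countable_of_fg_top {F K : Type*} [Field F] [Field K] [Algebra F K]
    [Countable F] (h : (⊤ : IntermediateField F K).FG) : Countable K := by
  obtain ⟨s, hs⟩ := h
  have hsurj : Function.Surjective fun p : MvPolynomial s F × MvPolynomial s F =>
      (MvPolynomial.aeval (Subtype.val : s → K) p.1 / MvPolynomial.aeval Subtype.val p.2) := by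
    intro x
    have hx : x ∈ IntermediateField.adjoin F (s : Set K) := hs ▸ IntermediateField.mem_top
    obtain ⟨r, q, rfl⟩ := (IntermediateField.mem_adjoin_iff F x).mp hx
    exact ⟨(r, q), rfl⟩
  have : Countable (MvPolynomial s F) := by
    exact (MvPolynomial.basisMonomials s F).repr.toEquiv.countable_iff.mpr inferInstance
  exact hsurj.countable

end FunctionField

/-! ### The height on φ(K)/φ(F). -/

namespace DrinfeldModule

open Polynomial

variable {Fq A F K : Type*} [Field Fq] [Fintype Fq] [CommRing A] [Algebra Fq A]
    [Field F] [Algebra Fq F] [Field K] [Algebra Fq K] [Algebra F K] {i : A →ₐ[Fq] F}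
    {V : Set (Valuation K (WithZero (Multiplicative ℤ)))}

theorem exists_coeff_ne_zero (φ : DrinfeldModule i) :
    ∃ t, ∃ n ≠ 0, (φ.toRingHom t).coeff n ≠ 0 := by
  obtain ⟨t, ht⟩ := φ.exists_ne
  refine ⟨t, ?_⟩
  by_contra! h
  refine ht (SkewPolynomial.ext fun n => ?_)
  change (φ.toRingHom t).coeff n = SkewPolynomial.coeff (SkewPolynomial.monomial 0 (i t)) n
  rw [SkewPolynomial.coeff_monomial]
  split_ifs with h0
  · rw [← h0, φ.coeff_zero]
  · exact h n (Ne.symm h0)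

theorem height_lt_height_smul (φ : DrinfeldModule i) (hV : IsPoleFamily F V) {t : A} {n : ℕ}
    (hn : n ≠ 0) (ht : (φ.toRingHom t).coeff n ≠ 0) (x : φ.Points K) (hx : hV.height x ≠ 0) :
    hV.height x < hV.height (t • x : φ.Points K) := by
  refine lt_of_lt_of_eq ?_
    (congrArg hV.height (TwistedPolynomial.eval_apply K (φ.toRingHom t) x).symm)
  exact hV.height_lt_height_sum hx _ (fun m hm => SkewPolynomial.mem_support_iff.mp hm)
    (pow_right_strictMono₀ Fintype.one_lt_card) (SkewPolynomial.mem_support_iff.mpr ht)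
    (one_lt_pow₀ Fintype.one_lt_card hn)

/-- Translation by a constant does not change the pole height, which therefore descends to the
quotient. Height zero characterises constants, so nonzero classes have positive height and t raises
it. -/
theorem exists_isModuleHeight (φ : DrinfeldModule i) (hV : IsPoleFamily F V)
    (hVF : ∀ y, (∀ v ∈ V, v y ≤ 1) → y ∈ Set.range (algebraMap F K)) {t : A} {n : ℕ}
    (hn : n ≠ 0) (ht : (φ.toRingHom t).coeff n ≠ 0)
    [Module Fq[X] (φ.Points K ⧸ φ.basePoints K)]
    (hX : ∀ m : φ.Points K ⧸ φ.basePoints K, (X : Fq[X]) • m = t • m) :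
    ∃ h : (φ.Points K ⧸ φ.basePoints K) → ℕ, IsModuleHeight Fq h ∧
      ∀ x : φ.Points K, h (Submodule.Quotient.mk x) = hV.height x := by
  have hle : ∀ x y : φ.Points K, x - y ∈ φ.basePoints K → hV.height x ≤ hV.height y := by
    rintro x y ⟨c, hc⟩
    -- The ultrametric inequality is stated for differences, hence x is written as (x - y) - (0 -
    -- y).
    have h := hV.height_sub_le (x - y : φ.Points K) (0 - y : φ.Points K)
    have h' := hV.height_sub_le (0 : φ.Points K) y
    have h0 : hV.height (0 : φ.Points K) = 0 := by
      have := hV.height_algebraMap 0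
      rwa [map_zero] at this
    have hxy : hV.height (x - y : φ.Points K) = 0 := by
      rw [← hc]
      exact hV.height_algebraMap c
    have hx : ((x - y : φ.Points K) - (0 - y : φ.Points K) : φ.Points K) = x := by abel
    change hV.height ((x - y : φ.Points K) - (0 - y : φ.Points K) : φ.Points K) ≤ _ at h
    change hV.height (0 - y : φ.Points K) ≤ _ at h'
    rw [hx, hxy] at h
    rw [h0] at h'
    omega
  choose r hr using Submodule.mkQ_surjective (φ.basePoints K)
  have hmk : ∀ x : φ.Points K, hV.height (r (Submodule.Quotient.mk x)) = hV.height x := fun x =>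
    le_antisymm (hle _ _ ((Submodule.Quotient.eq _).mp (hr _)))
      (hle _ _ ((Submodule.Quotient.eq _).mp (hr _).symm))
  refine ⟨fun m => hV.height (r m), ⟨fun m m' => ?_, fun m hm => ?_⟩, hmk⟩
  · obtain ⟨x, rfl⟩ := Submodule.mkQ_surjective _ m
    obtain ⟨y, rfl⟩ := Submodule.mkQ_surjective _ m'
    rw [← map_sub]
    simp only [Submodule.mkQ_apply, hmk]
    exact hV.height_sub_le x y
  · obtain ⟨x, rfl⟩ := Submodule.mkQ_surjective _ m
    rw [hX, ← map_smul]
    simp only [Submodule.mkQ_apply, hmk]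
    refine φ.height_lt_height_smul hV hn ht x fun h => hm ?_
    rw [Submodule.mkQ_apply, Submodule.Quotient.mk_eq_zero]
    exact hVF x (hV.height_eq_zero_iff.mp h)

/-- The multiples c x with c in F have height at most that of x. They are distinct modulo F, since
(c - c') x in F with c ≠ c' would put x in F. -/
theorem infinite_setOf_height_le [Infinite F] (φ : DrinfeldModule i) (hV : IsPoleFamily F V)
    {h : (φ.Points K ⧸ φ.basePoints K) → ℕ}
    (hh : ∀ x : φ.Points K, h (Submodule.Quotient.mk x) = hV.height x)
    {x : K} (hx : x ∉ Set.range (algebraMap F K)) : {m | h m ≤ hV.height x}.Infinite := by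
  let f : F → φ.Points K ⧸ φ.basePoints K := fun c =>
    Submodule.Quotient.mk (algebraMap F K c * x : K)
  have hf : Function.Injective f := by
    intro c c' hcc
    obtain ⟨d, hd⟩ := (Submodule.Quotient.eq _).mp hcc
    change algebraMap F K d = algebraMap F K c * x - algebraMap F K c' * x at hd
    by_contra hne
    refine hx ⟨d / (c - c'), ?_⟩
    have hne' : algebraMap F K c - algebraMap F K c' ≠ 0 := by
      rw [← map_sub]
      simpa [sub_eq_zero] using hne
    rw [map_div₀, map_sub, hd, ← sub_mul, mul_div_cancel_left₀ _ hne']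
  refine (Set.infinite_range_of_injective hf).mono ?_
  rintro _ ⟨c, rfl⟩
  exact (hh _).trans_le (hV.height_algebraMap_mul_le c x)

end DrinfeldModule

/-! ### Splitting off φ(F). -/

theorem Submodule.exists_isCompl_of_projective_quotient {A M : Type*} [CommRing A] [AddCommGroup M]
    [Module A M] (S : Submodule A M) [Module.Projective A (M ⧸ S)] :
    ∃ N : Submodule A M, IsCompl S N := by
  obtain ⟨s, hs⟩ := S.mkQ.exists_rightInverse_of_surjective (Submodule.range_mkQ S)
  have hs' : ∀ q, Submodule.Quotient.mk (s q) = q := fun q => congr($hs q)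
  refine ⟨LinearMap.range s, ⟨Submodule.disjoint_def.mpr ?_, 
    Submodule.codisjoint_iff_exists_add_eq.mpr
    fun x => ⟨x - s (S.mkQ x), s (S.mkQ x), (Submodule.Quotient.eq S).mp (hs' _).symm, ⟨_, rfl⟩,
      sub_add_cancel _ _⟩⟩⟩
  rintro _ hx ⟨q, rfl⟩
  rw [← Submodule.Quotient.mk_eq_zero, hs'] at hx
  rw [hx, map_zero]

theorem theoremT {Fq k F K : Type*}
    [Field Fq] [Fintype Fq]
    [Field k] [Algebra Fq k]
    (hk_fg : (⊤ : IntermediateField Fq k).FG) (hk_trdeg : Algebra.trdeg Fq k = 1)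
    (pt : ClosedPoint Fq k)
    [Field F] [Algebra Fq F] [Countable F] [IsAlgClosed F]
    [Field K] [Algebra Fq K] [Algebra F K] [IsScalarTower Fq F K]
    (hK_fg : (⊤ : IntermediateField F K).FG) (hK_trdeg : 0 < Algebra.trdeg F K)
    (i : ringRegularAwayFrom pt →ₐ[Fq] F) (φ : DrinfeldModule i) :
    ∃ N : Submodule (ringRegularAwayFrom pt) (φ.Points K),
      IsCompl (φ.basePoints K) N ∧
      Module.Free (ringRegularAwayFrom pt) N ∧
      Module.rank (ringRegularAwayFrom pt) N = Cardinal.aleph0 := by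
  have : Algebra.EssFiniteType Fq k := IntermediateField.fg_top_iff.mp hk_fg
  have : Algebra.EssFiniteType F K := IntermediateField.fg_top_iff.mp hK_fg
  have hK_alg : ¬ Algebra.IsAlgebraic F K := fun h =>
    hK_trdeg.ne' trdeg_eq_zero
  obtain ⟨V, hV, hVF⟩ := exists_isPoleFamily hK_alg
  obtain ⟨t, n, hn, ht⟩ := φ.exists_coeff_ne_zero
  let A := ringRegularAwayFrom pt
  let M := φ.Points K ⧸ φ.basePoints K
  let _ : Algebra (Polynomial Fq) A := (Polynomial.aeval t).toRingHom.toAlgebra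
  let _ : Module (Polynomial Fq) M := Module.compHom M (Polynomial.aeval t).toRingHom
  have : IsScalarTower Fq (Polynomial Fq) A := .of_algebraMap_eq fun c =>
    (Polynomial.aeval_C t c).symm
  have : IsScalarTower (Polynomial Fq) A M := .of_algebraMap_smul fun _ _ => rfl
  obtain ⟨h, hh, hmk⟩ := φ.exists_isModuleHeight hV hVF hn ht fun m => by
    change Polynomial.aeval t Polynomial.X • m = t • m
    rw [Polynomial.aeval_X]
  obtain ⟨x, hx⟩ : ∃ x, x ∉ Set.range (algebraMap F K) := by
    by_contra! hsurj
    refine hK_alg ⟨fun y => ?_⟩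
    obtain ⟨c, rfl⟩ := hsurj y
    exact isAlgebraic_algebraMap c
  have : Infinite F := inferInstance
  have hinf := φ.infinite_setOf_height_le hV hmk hx
  -- t is transcendental over Fq: a polynomial vanishing at t would annihilate M, which is nonzero
  -- and torsion-free over Fq[X].
  have hinj : Function.Injective (algebraMap (Polynomial Fq) A) := by
    have := hh.isTorsionFree
    obtain ⟨m, hm⟩ : ∃ m : M, m ≠ 0 := by
      by_contra! h0
      exact hinf ((Set.finite_singleton 0).subset fun m _ => h0 m)
    refine (injective_iff_map_eq_zero _).mpr fun p hp => ?_
    have hpm : p • m = 0 := by rw [← algebraMap_smul A, hp, zero_smul]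
    exact (smul_eq_zero.mp hpm).resolve_right hm
  obtain ⟨halg, hrank⟩ := A.isAlgebraic_and_rank_lt_aleph0 hk_trdeg hinj
  have : IsIntegrallyClosed A := isIntegrallyClosed_ringRegularAwayFrom pt
  have : Countable K := IntermediateField.countable_of_fg_top hK_fg
  have : Countable (φ.Points K) := ‹Countable K›
  have : Countable M := (Submodule.mkQ_surjective (φ.basePoints K)).countable
  obtain ⟨e⟩ := hh.nonempty_finsupp_equiv (A := A) hrank _ hinf
  have : Module.Projective A M := .of_equiv e.symm
  obtain ⟨N, hN⟩ := (φ.basePoints K).exists_isCompl_of_projective_quotient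
  let b : Module.Basis ℕ A N := .ofRepr ((Submodule.quotientEquivOfIsCompl _ N hN).symm.trans e)
  exact ⟨N, hN, .of_basis b, by simpa using b.mk_eq_rank.symm⟩
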